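/- Let $h(t) = -\lambda t + o(t)$, $\lambda > 0$, be a real analytic germ at $0$, and let $N \in \mathbb{N}$. Then there is a real analytic vector field $V$ on an open neighbourhood $U$ of the origin in $\mathbb{R}^2$, with a non-degenerate monodromic singularity at the origin (that is, $V(0,0) = (0,0)$ and the eigenvalues of the linear part $DV(0,0)$ have non-zero imaginary part), whose semi-monodromy map $m$ on the $x$-axis is formally equivalent to $h$ and satisfies $h(t) - m(t) = o(t^N)$ as $t \to 0$. Here $m$ is the analytic germ at $0$ with $m(0) = 0$, $m'(0) < 0$ such that, for every $\delta > 0$ and all sufficiently small $t \neq 0$, $|m(t)|<\delta$ and $(m(t), 0)$ is the first point at which the forward trajectory of $V$ (in $U$) through $(t, 0)$ intersects the segment $(-\delta, \delta) \times \{0\}$ at a positive time. Two analytic germs $f, g$ at $0$ that vanish at $0$ and have non-zero derivative there are called formally equivalent if for every $M \in \mathbb{N}$ there is a local diffeomorphism $\varphi(t) = t + o(t)$, analytic at $0$, such that $\varphi \circ f \circ \varphi^{-1}(t) = g(t) + o(t^M)$ as $t \to 0$. -/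

import Mathlib

open Set Filter Topology Asymptotics

/-- The origin is a non-degenerate monodromic singularity of the planar vector field `V`:
`V` vanishes there and every eigenvalue of the linear part, i.e. every complex root of its
characteristic polynomial, has non-zero imaginary part. -/
def IsNondegenerateMonodromic (V : ℝ × ℝ → ℝ × ℝ) : Prop :=
  V 0 = 0 ∧
    ∀ z : ℂ, Polynomial.aeval z
      (LinearMap.charpoly (fderiv ℝ V 0 : ℝ × ℝ →ₗ[ℝ] ℝ × ℝ)) = 0 → z.im ≠ 0

/-- `IsFirstIntersection U V S p q`: the forward trajectory of the vector field `V` on `U`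
through `p` meets `S` after a positive time, and the first such point is `q`. -/
def IsFirstIntersection (U : Set (ℝ × ℝ)) (V : ℝ × ℝ → ℝ × ℝ) (S : Set (ℝ × ℝ))
    (p q : ℝ × ℝ) : Prop :=
  ∃ (T : ℝ) (c : ℝ → ℝ × ℝ), 0 < T ∧ IsIntegralCurveOn c (fun _ => V) (Icc 0 T) ∧
    (∀ s ∈ Icc 0 T, c s ∈ U) ∧ c 0 = p ∧ (∀ s ∈ Ioo 0 T, c s ∉ S) ∧ c T = q ∧ q ∈ S

/-- `m` represents the semi-monodromy map at the origin of the vector field `V` on `U` with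
respect to the transversal parametrized by `γ : (-δ, δ) → ℝ²`, `γ 0 = 0`: there is
`ε ∈ (0, δ)` such that `m` is an analytic map from `(-ε, ε)` to `(-δ, δ)` with `m 0 = 0` and
`m' 0 < 0`, and for `t ≠ 0` in `(-ε, ε)` the point `γ (m t)` is the first point at which the
forward trajectory through `γ t` intersects the image of `γ`. -/
def IsSemiMonodromy (U : Set (ℝ × ℝ)) (V : ℝ × ℝ → ℝ × ℝ) (γ : ℝ → ℝ × ℝ) (δ : ℝ)
    (m : ℝ → ℝ) : Prop :=
  ∃ ε : ℝ, 0 < ε ∧ ε < δ ∧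
    AnalyticOnNhd ℝ m (Ioo (-ε) ε) ∧ MapsTo m (Ioo (-ε) ε) (Ioo (-δ) δ) ∧
    m 0 = 0 ∧ deriv m 0 < 0 ∧
    ∀ t ∈ Ioo (-ε) ε, t ≠ 0 →
      IsFirstIntersection U V (γ '' Ioo (-δ) δ) (γ t) (γ (m t))

/-- Formal equivalence, at the origin, of germs `f` and `g`: to any finite order they are
conjugate by an analytic local diffeomorphism `φ` with `φ(t) = t + o(t)`; the germ `ψ` is the
inverse of `φ`. -/
def FormallyEquivalent (f g : ℝ → ℝ) : Prop :=
  ∀ N : ℕ, ∃ φ ψ : ℝ → ℝ, AnalyticAt ℝ φ 0 ∧ AnalyticAt ℝ ψ 0 ∧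
    (fun t => φ t - t) =o[𝓝 0] (fun t => t) ∧
    (∀ᶠ t in 𝓝 0, ψ (φ t) = t) ∧ (∀ᶠ t in 𝓝 0, φ (ψ t) = t) ∧
    (fun t => φ (f (ψ t)) - g t) =o[𝓝 0] (fun t => t ^ N)

/-! It suffices to find one half-turn germ `M` of an explicit analytic field that is conjugate to
`h` to every finite order (`exists_isHalfTurnGerm_nearConj`). Given `N`, take a coordinate `φ`
conjugating `h` to `M` up to `o(t ^ N)` and rewrite the field in coordinates where `(φ x, y)` are
the old ones. The `x`-axis is preserved, so the semi-monodromy becomes `φ⁻¹ ∘ M ∘ φ`: it is `o(t ^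
N)`-close to `h` and, being an exact conjugate of `M`, formally equivalent to `h`.

The germ `M` comes from formal normal forms. If `lam ≠ 1` nothing is resonant and `h` is formally
`-lam t`, the half-turn germ of a linear focus. If `lam = 1`, only odd degrees are resonant: either
`h` is formally `-t`, or a first term `a t ^ (2 k + 1)` survives. In the latter case it serves to
remove every later term except that of degree `4 k + 1` (`NearConj.succ_of_ne_four_mul`), so `k`,
`a` and one more coefficient determine the formal class.

These data are realized by `r' = ε r ^ (2 k + 1)`, `θ' = 1 + c r ^ (2 k)`, which integrates
explicitly: `ε` prescribes `a = -ε π`, and `c` shifts the coefficient of degree `4 k + 1` by `ε c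
π`, hence arbitrarily. -/

/-- `φ` is an analytic change of coordinate at `0` tangent to the identity, with inverse `ψ`. -/
structure IsGermCoord (φ ψ : ℝ → ℝ) : Prop where
  analytic : AnalyticAt ℝ φ 0
  analytic_inv : AnalyticAt ℝ ψ 0
  tangent : (fun t => φ t - t) =o[𝓝 0] (fun t => t)
  left_inv : ∀ᶠ t in 𝓝 0, ψ (φ t) = t
  right_inv : ∀ᶠ t in 𝓝 0, φ (ψ t) = t

/-- Up to an error `o(t ^ n)`, the germ `f` is conjugate to `g` by a germ tangent to `id`. -/
def NearConj (n : ℕ) (f g : ℝ → ℝ) : Prop :=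
  ∃ φ ψ, IsGermCoord φ ψ ∧ (fun t => φ (f (ψ t)) - g t) =o[𝓝 0] (fun t => t ^ n)

/-! ### Germs at `0` and coordinates tangent to the identity -/

theorem isLittleO_sub_mul_id_iff {f : ℝ → ℝ} {a : ℝ} :
    (fun t => f t - a * t) =o[𝓝 0] (fun t => t) ↔ f 0 = 0 ∧ HasDerivAt f a 0 := by
  constructor
  · intro h
    have h0 : f 0 = 0 := by
      have := h.bound (c := 1) one_pos
      simpa using this.self_of_nhds
    refine ⟨h0, ?_⟩
    rw [hasDerivAt_iff_isLittleO]
    simpa [h0, mul_comm] using h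
  · rintro ⟨h0, h⟩
    rw [hasDerivAt_iff_isLittleO] at h
    simpa [h0, mul_comm] using h

theorem hasDerivAt_tangent {f : ℝ → ℝ} :
    (fun t => f t - t) =o[𝓝 0] (fun t => t) ↔ f 0 = 0 ∧ HasDerivAt f 1 0 := by
  simpa using isLittleO_sub_mul_id_iff (f := f) (a := 1)

theorem tendsto_zero_of_hasDerivAt {f : ℝ → ℝ} {a : ℝ} (h0 : f 0 = 0) (h : HasDerivAt f a 0) :
    Tendsto f (𝓝 0) (𝓝 0) := by
  simpa [h0] using h.continuousAt.tendsto

theorem isBigO_id_of_hasDerivAt {f : ℝ → ℝ} {a : ℝ} (h0 : f 0 = 0) (h : HasDerivAt f a 0) :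
    f =O[𝓝 0] (fun t => t) := by
  simpa [h0] using h.isBigO_sub

/-- Precomposition with a germ fixing `0` preserves `o(t ^ n)`. -/
theorem IsLittleO.comp_germ {e f : ℝ → ℝ} {a : ℝ} {n : ℕ}
    (he : e =o[𝓝 0] (fun t => t ^ n)) (h0 : f 0 = 0) (h : HasDerivAt f a 0) :
    (fun t => e (f t)) =o[𝓝 0] (fun t => t ^ n) :=
  (he.comp_tendsto (tendsto_zero_of_hasDerivAt h0 h)).trans_isBigO
    ((isBigO_id_of_hasDerivAt h0 h).pow n)

namespace IsGermCoord

variable {φ ψ φ₁ ψ₁ : ℝ → ℝ}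

theorem map_zero (h : IsGermCoord φ ψ) : φ 0 = 0 := (hasDerivAt_tangent.1 h.tangent).1

theorem hasDerivAt (h : IsGermCoord φ ψ) : HasDerivAt φ 1 0 := (hasDerivAt_tangent.1 h.tangent).2

theorem map_zero_inv (h : IsGermCoord φ ψ) : ψ 0 = 0 := by
  simpa [h.map_zero] using h.left_inv.self_of_nhds

theorem hasStrictDerivAt (h : IsGermCoord φ ψ) : HasStrictDerivAt φ 1 0 := by
  simpa [h.hasDerivAt.deriv] using h.analytic.hasStrictDerivAt

theorem hasDerivAt_inv (h : IsGermCoord φ ψ) : HasDerivAt ψ 1 0 := by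
  have := (h.hasStrictDerivAt.to_local_left_inverse one_ne_zero h.left_inv).hasDerivAt
  simpa [h.map_zero] using this

theorem symm (h : IsGermCoord φ ψ) : IsGermCoord ψ φ :=
  ⟨h.analytic_inv, h.analytic, hasDerivAt_tangent.2 ⟨h.map_zero_inv, h.hasDerivAt_inv⟩,
    h.right_inv, h.left_inv⟩

theorem tendsto (h : IsGermCoord φ ψ) : Tendsto φ (𝓝 0) (𝓝 0) :=
  tendsto_zero_of_hasDerivAt h.map_zero h.hasDerivAt

theorem comp (h : IsGermCoord φ ψ) (h₁ : IsGermCoord φ₁ ψ₁) :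
    IsGermCoord (φ₁ ∘ φ) (ψ ∘ ψ₁) where
  analytic := AnalyticAt.comp (by simpa [h.map_zero] using h₁.analytic) h.analytic
  analytic_inv :=
    AnalyticAt.comp (by simpa [h₁.map_zero_inv] using h.analytic_inv) h₁.analytic_inv
  tangent := by
    refine hasDerivAt_tangent.2 ⟨by simp [h.map_zero, h₁.map_zero], ?_⟩
    have := HasDerivAt.comp (x := (0 : ℝ)) (h₂ := φ₁) (h := φ) (h₂' := 1)
      (by simpa [h.map_zero] using h₁.hasDerivAt) h.hasDerivAt
    simpa using this
  left_inv := by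
    filter_upwards [h.left_inv, h.tendsto.eventually h₁.left_inv] with t h1 h2
    simp [h1, h2]
  right_inv := by
    filter_upwards [h₁.right_inv, h₁.symm.tendsto.eventually h.right_inv] with t h1 h2
    simp [h1, h2]

theorem refl : IsGermCoord id id :=
  ⟨analyticAt_id, analyticAt_id, hasDerivAt_tangent.2 ⟨rfl, hasDerivAt_id _⟩,
    .of_forall fun _ => rfl, .of_forall fun _ => rfl⟩

theorem of_analyticAt (h : AnalyticAt ℝ φ 0) (h0 : φ 0 = 0) (h1 : HasDerivAt φ 1 0) :
    ∃ ψ, IsGermCoord φ ψ := by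
  have hd : deriv φ 0 ≠ 0 := by simp [h1.deriv]
  refine ⟨_, h, by simpa [h0] using h.analyticAt_localInverse hd, hasDerivAt_tangent.2 ⟨h0, h1⟩,
    h.hasStrictDerivAt.eventually_left_inverse hd, ?_⟩
  simpa only [h0] using h.hasStrictDerivAt.eventually_right_inverse hd

/-- Postcomposition with a change of coordinate does not increase differences. -/
theorem isBigO_sub (h : IsGermCoord φ ψ) {f g : ℝ → ℝ} (hf : Tendsto f (𝓝 0) (𝓝 0))
    (hg : Tendsto g (𝓝 0) (𝓝 0)) :
    (fun t => φ (f t) - φ (g t)) =O[𝓝 0] (fun t => f t - g t) := by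
  have := h.hasStrictDerivAt.isBigO_sub
  exact this.comp_tendsto (k := fun t => (f t, g t)) (hf.prodMk_nhds hg)

end IsGermCoord

/-! ### Orders of vanishing and leading coefficients -/

theorem isBigO_pow_pow {m n : ℕ} (h : m ≤ n) :
    (fun t : ℝ => t ^ n) =O[𝓝 0] (fun t => t ^ m) := by
  refine IsBigO.of_bound 1 ?_
  filter_upwards [Metric.ball_mem_nhds (0 : ℝ) one_pos] with t ht
  rw [one_mul, norm_pow, norm_pow]
  exact pow_le_pow_of_le_one (norm_nonneg t) (mem_ball_zero_iff.1 ht).le h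

/-- An analytic germ that is `o(t ^ n)` is divisible by `t ^ (n + 1)`. -/
theorem AnalyticAt.exists_eq_pow_mul {f : ℝ → ℝ} {n : ℕ} (hf : AnalyticAt ℝ f 0)
    (h : f =o[𝓝 0] (fun t => t ^ n)) :
    ∃ q, AnalyticAt ℝ q 0 ∧ ∀ᶠ t in 𝓝 0, f t = t ^ (n + 1) * q t := by
  have key : ((n + 1 : ℕ) : ℕ∞) ≤ analyticOrderAt f 0 := by
    by_contra hlt
    push Not at hlt
    obtain ⟨j, hj⟩ := ENat.ne_top_iff_exists.1 hlt.ne_top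
    rw [← hj, ENat.natCast_lt_natCast] at hlt
    obtain ⟨g, hg, hg0, hfg⟩ := (hf.analyticOrderAt_eq_natCast).1 hj.symm
    -- With order `j ≤ n`, dividing `f = o(t ^ j)` by `t ^ j` off the origin forces `g → 0`, against
    -- `g 0 ≠ 0`.
    have h1 : (fun t : ℝ => t ^ j * g t) =o[𝓝[≠] 0] (fun t => t ^ j * 1) := by
      refine ((h.trans_isBigO (isBigO_pow_pow (m := j) (by omega))).congr' ?_ (.of_forall fun t => by simp)).mono nhdsWithin_le_nhds
      filter_upwards [hfg] with t ht using by simpa using ht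
    have h3 : g =o[𝓝[≠] 0] (fun _ => (1 : ℝ)) := by
      rw [isLittleO_iff] at h1 ⊢
      intro c hc
      filter_upwards [h1 hc, self_mem_nhdsWithin] with t ht ht0
      have : 0 < ‖t ^ j‖ := norm_pos_iff.2 (pow_ne_zero _ ht0)
      rw [norm_mul, norm_mul] at ht
      nlinarith
    rw [isLittleO_one_iff] at h3
    exact hg0 (tendsto_nhds_unique (hg.continuousAt.tendsto.mono_left nhdsWithin_le_nhds) h3)
  obtain ⟨q, hq, h⟩ := (natCast_le_analyticOrderAt hf).1 key
  exact ⟨q, hq, by simpa using h⟩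

theorem isLittleO_pow_mul {e : ℝ → ℝ} (he : Tendsto e (𝓝 0) (𝓝 0)) (n : ℕ) :
    (fun t => t ^ n * e t) =o[𝓝 0] (fun t => t ^ n) := by
  simpa using (isBigO_refl (fun t : ℝ => t ^ n) (𝓝 0)).mul_isLittleO
    ((isLittleO_one_iff ℝ).2 he)

theorem AnalyticAt.exists_leading_coeff {f : ℝ → ℝ} {n : ℕ} (hf : AnalyticAt ℝ f 0)
    (h : f =o[𝓝 0] (fun t => t ^ n)) :
    ∃ d : ℝ, (fun t => f t - d * t ^ (n + 1)) =o[𝓝 0] (fun t => t ^ (n + 1)) := by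
  obtain ⟨q, hq, hfq⟩ := hf.exists_eq_pow_mul h
  refine ⟨q 0, ?_⟩
  have h0 : Tendsto (fun t => q t - q 0) (𝓝 0) (𝓝 0) := by
    simpa using hq.continuousAt.tendsto.sub_const (q 0)
  refine (isLittleO_pow_mul h0 (n + 1)).congr' ?_ .rfl
  filter_upwards [hfq] with t ht
  rw [ht]; ring

/-! ### Conjugacy up to finite order -/

theorem NearConj.mono {m n : ℕ} {f g : ℝ → ℝ} (h : NearConj n f g) (hmn : m ≤ n) :
    NearConj m f g := by
  obtain ⟨φ, ψ, hc, h⟩ := h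
  exact ⟨φ, ψ, hc, h.trans_isBigO (isBigO_pow_pow hmn)⟩

theorem NearConj.of_isLittleO {n : ℕ} {f g : ℝ → ℝ}
    (h : (fun t => f t - g t) =o[𝓝 0] (fun t => t ^ n)) : NearConj n f g :=
  ⟨id, id, .refl, h⟩

/-- A solution of the conjugacy equation up to `o(t ^ n)`, read in the new coordinate. -/
theorem NearConj.of_comp_sub_comp {n : ℕ} {f g φ : ℝ → ℝ} (hφ : AnalyticAt ℝ φ 0)
    (h0 : φ 0 = 0) (h1 : HasDerivAt φ 1 0)
    (h : (fun t => φ (f t) - g (φ t)) =o[𝓝 0] (fun t => t ^ n)) : NearConj n f g := by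
  obtain ⟨ψ, hc⟩ := IsGermCoord.of_analyticAt hφ h0 h1
  refine ⟨φ, ψ, hc, (IsLittleO.comp_germ h hc.map_zero_inv hc.hasDerivAt_inv).congr' ?_ .rfl⟩
  filter_upwards [hc.right_inv] with t ht
  rw [ht]

theorem NearConj.comp_left {n : ℕ} {f g φ ψ : ℝ → ℝ} (hc : IsGermCoord φ ψ)
    (h : NearConj n (fun t => φ (f (ψ t))) g) : NearConj n f g := by
  obtain ⟨φ₁, ψ₁, hc₁, h⟩ := h
  exact ⟨_, _, hc.comp hc₁, h⟩

/-- Substitute `φ t` for `t` and apply `ψ`: the first preserves orders because `φ t = O(t)`, the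
second because `ψ` is Lipschitz near `0`. -/
theorem NearConj.isLittleO_pullback {n : ℕ} {f g φ ψ : ℝ → ℝ} (hc : IsGermCoord φ ψ)
    (hf : Tendsto f (𝓝 0) (𝓝 0)) (hg : Tendsto g (𝓝 0) (𝓝 0))
    (h : (fun t => φ (f (ψ t)) - g t) =o[𝓝 0] (fun t => t ^ n)) :
    (fun t => f t - ψ (g (φ t))) =o[𝓝 0] (fun t => t ^ n) := by
  have h1 := IsLittleO.comp_germ h hc.map_zero hc.hasDerivAt
  have h2 := hc.symm.isBigO_sub
    (hc.tendsto.comp (hf.comp (hc.symm.tendsto.comp hc.tendsto))) (hg.comp hc.tendsto)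
  refine (h2.trans_isLittleO h1).congr' ?_ .rfl
  filter_upwards [hc.left_inv, hf.eventually hc.left_inv] with t h3 h4
  simp [h3, h4]

/-- If `h` is conjugate to `M` to every finite order, so is every exact conjugate of `M`. -/
theorem formallyEquivalent_of_nearConj {h M φ ψ : ℝ → ℝ} (hc : IsGermCoord φ ψ)
    (hh : Tendsto h (𝓝 0) (𝓝 0)) (hM : Tendsto M (𝓝 0) (𝓝 0)) (H : ∀ n, NearConj n h M) :
    FormallyEquivalent (fun t => ψ (M (φ t))) h := by
  intro n
  obtain ⟨φ₁, ψ₁, hc₁, h1⟩ := H n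
  have h2 := NearConj.isLittleO_pullback hc₁ hh hM h1
  -- `φ` turns the exact conjugate into `M`, and `ψ₁` turns `M` into `h` up to `o(t ^ n)`.
  have hc₂ := hc.comp hc₁.symm
  refine ⟨ψ₁ ∘ φ, ψ ∘ φ₁, hc₂.analytic, hc₂.analytic_inv, hc₂.tangent, hc₂.left_inv,
    hc₂.right_inv, h2.neg_left.congr' ?_ .rfl⟩
  filter_upwards [hc₁.tendsto.eventually hc.right_inv,
    (hM.comp hc₁.tendsto).eventually hc.right_inv] with t h3 h4
  simp only [Function.comp_apply] at h3 h4 ⊢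
  rw [h3, h4]; ring

/-! ### Power expansions and removal of one coefficient -/

/-- Leading terms of a power of `s t + a t ^ (l + 1) + o(t ^ (l + 1))`. -/
theorem isLittleO_pow_expansion {f : ℝ → ℝ} {s a : ℝ} {l : ℕ} (hl : 1 ≤ l)
    (hf : (fun t => f t - s * t - a * t ^ (l + 1)) =o[𝓝 0] (fun t => t ^ (l + 1))) (p : ℕ) :
    (fun t => f t ^ (p + 1) - s ^ (p + 1) * t ^ (p + 1) - (p + 1) * s ^ p * a * t ^ (p + 1 + l))
      =o[𝓝 0] (fun t => t ^ (p + 1 + l)) := by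
  have h1 : (fun t => f t - s * t) =o[𝓝 0] (fun t => t) := by
    have h2 : (fun t : ℝ => a * t ^ (l + 1)) =o[𝓝 0] (fun t => t) := by
      simpa using (isLittleO_pow_pow (𝕜 := ℝ) (show 1 < l + 1 by omega)).const_mul_left a
    have h3 : (fun t : ℝ => t ^ (l + 1)) =O[𝓝 0] (fun t => t) := by
      simpa using isBigO_pow_pow (show 1 ≤ l + 1 by omega)
    exact ((hf.trans_isBigO h3).add h2).congr_left fun t => by ring
  have h4 : f =O[𝓝 0] (fun t => t) :=
    (h1.isBigO.add ((isBigO_refl _ _).const_mul_left s)).congr_left fun t => by ring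
  induction p with
  | zero => simpa [add_comm] using hf
  | succ p ih =>
    have e1 := h4.mul_isLittleO ih
    have e2 := hf.mul_isBigO (isBigO_refl (fun t : ℝ => s ^ (p + 1) * t ^ (p + 1)) (𝓝 0))
    have e3 := h1.mul_isBigO
      (isBigO_refl (fun t : ℝ => (p + 1) * s ^ p * a * t ^ (p + 1 + l)) (𝓝 0))
    have r1 : (fun t : ℝ => t * t ^ (p + 1 + l)) =O[𝓝 0] (fun t => t ^ (p + 1 + 1 + l)) :=
      (isBigO_refl _ _).congr_left fun t => by ring
    have r2 : (fun t : ℝ => t ^ (l + 1) * (s ^ (p + 1) * t ^ (p + 1)))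
        =O[𝓝 0] (fun t => t ^ (p + 1 + 1 + l)) :=
      ((isBigO_refl _ _).const_mul_left (s ^ (p + 1))).congr_left fun t => by ring
    have r3 : (fun t : ℝ => t * ((p + 1) * s ^ p * a * t ^ (p + 1 + l)))
        =O[𝓝 0] (fun t => t ^ (p + 1 + 1 + l)) :=
      ((isBigO_refl _ _).const_mul_left ((p + 1) * s ^ p * a)).congr_left fun t => by ring
    refine (((e1.trans_isBigO r1).add (e2.trans_isBigO r2)).add
      (e3.trans_isBigO r3)).congr_left fun t => ?_
    push_cast
    ring

theorem isLittleO_pow_sub_pow {f : ℝ → ℝ} {a : ℝ}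
    (hf : (fun t => f t - a * t) =o[𝓝 0] (fun t => t)) (m : ℕ) :
    (fun t => f t ^ m - a ^ m * t ^ m) =o[𝓝 0] (fun t => t ^ m) := by
  have h4 : f =O[𝓝 0] (fun t => t) :=
    (hf.isBigO.add ((isBigO_refl _ _).const_mul_left a)).congr_left fun t => by ring
  induction m with
  | zero => simp
  | succ m ih =>
    have e1 := h4.mul_isLittleO ih
    have e2 := hf.mul_isBigO ((isBigO_refl (fun t : ℝ => t ^ m) (𝓝 0)).const_mul_left (a ^ m))
    exact (e1.add e2).congr (fun t => by ring) fun t => by ring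

theorem hasDerivAt_id_add_mul_pow (β : ℝ) {p : ℕ} (hp : 2 ≤ p) :
    HasDerivAt (fun t : ℝ => t + β * t ^ p) 1 0 := by
  have h := (hasDerivAt_id' (0 : ℝ)).fun_add ((hasDerivAt_pow p (0 : ℝ)).const_mul β)
  simpa [zero_pow (show p - 1 ≠ 0 by omega)] using h

theorem IsGermCoord.analyticAt_conj {f φ ψ : ℝ → ℝ} (hc : IsGermCoord φ ψ)
    (hf : AnalyticAt ℝ f 0) (h0 : f 0 = 0) : AnalyticAt ℝ (fun t => φ (f (ψ t))) 0 := by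
  have h1 : AnalyticAt ℝ (fun t => f (ψ t)) 0 :=
    AnalyticAt.fun_comp (by rwa [hc.map_zero_inv]) hc.analytic_inv
  exact AnalyticAt.fun_comp (by simpa [hc.map_zero_inv, h0] using hc.analytic) h1

/-- Coordinates compose, so an elimination step need only treat germs that already agree with `g` to
order `n`. -/
theorem NearConj.succ_of_forall {n : ℕ} {h g : ℝ → ℝ} (ha : AnalyticAt ℝ h 0) (h0 : h 0 = 0)
    (H : ∀ f, AnalyticAt ℝ f 0 → f 0 = 0 → (fun t => f t - g t) =o[𝓝 0] (fun t => t ^ n) →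
      NearConj (n + 1) f g)
    (hn : NearConj n h g) : NearConj (n + 1) h g := by
  obtain ⟨φ, ψ, hc, hs⟩ := hn
  refine NearConj.comp_left hc (H _ (hc.analyticAt_conj ha h0) ?_ hs)
  · simp [hc.map_zero_inv, h0, hc.map_zero]

/-- The coordinate `t + β t ^ (n + 1)` changes the coefficient of degree `n + 1` by `β (a ^ (n + 1)
- a)`; without resonance this cancels any discrepancy `d`. -/
theorem NearConj.succ_of_pow_ne {n : ℕ} {h g : ℝ → ℝ} {a : ℝ} (ha : AnalyticAt ℝ h 0)
    (h0 : h 0 = 0) (hg : AnalyticAt ℝ g 0) (hga : (fun t => g t - a * t) =o[𝓝 0] (fun t => t))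
    (hn1 : 1 ≤ n) (hne : a ^ (n + 1) ≠ a) (hn : NearConj n h g) : NearConj (n + 1) h g := by
  refine hn.succ_of_forall ha h0 fun f hf _ hfg => ?_
  obtain ⟨d, hd⟩ := (hf.sub hg).exists_leading_coeff hfg
  have hga' := isLittleO_sub_mul_id_iff.1 hga
  obtain ⟨β, hβ⟩ : ∃ β : ℝ, d + β * a ^ (n + 1) - a * β = 0 := by
    refine ⟨d / (a - a ^ (n + 1)), ?_⟩
    have := sub_ne_zero.2 hne.symm
    field_simp
    ring
  have h1 := hasDerivAt_id_add_mul_pow β (show 2 ≤ n + 1 by omega)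
  have ht := tendsto_zero_of_hasDerivAt (by simp) h1
  refine NearConj.of_comp_sub_comp (φ := fun t => t + β * t ^ (n + 1)) (by fun_prop) (by simp)
    h1 ?_
  have hfa : (fun t => f t - a * t) =o[𝓝 0] (fun t => t) := by
    have := hfg.trans_isBigO (isBigO_pow_pow hn1)
    simp only [pow_one] at this
    exact (this.add hga).congr_left fun t => by ring
  have e2 := (isLittleO_pow_sub_pow hfa (n + 1)).const_mul_left β
  have hsg : HasStrictDerivAt g a 0 := by simpa [hga'.2.deriv] using hg.hasStrictDerivAt
  have e3 := hsg.hasStrictFDerivAt.isLittleO.comp_tendsto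
    (k := fun t : ℝ => (t + β * t ^ (n + 1), t)) (ht.prodMk_nhds tendsto_id)
  -- Strict differentiability of `g` at `0` linearizes the increment between two moving points.
  have e3' : (fun t => g (t + β * t ^ (n + 1)) - g t - a * (β * t ^ (n + 1)))
      =o[𝓝 0] (fun t => t ^ (n + 1)) := by
    refine (e3.congr (fun t => ?_) (fun t => ?_)).trans_isBigO
      ((isBigO_refl (fun t : ℝ => t ^ (n + 1)) (𝓝 0)).const_mul_left β)
    · simp [mul_comm]
    · simp
  refine ((hd.add e2).sub e3').congr_left fun t => ?_
  simp only [Pi.sub_apply]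
  linear_combination (-(t ^ (n + 1))) * hβ

/-- For even `n = 2 k + P` the linear part `-t` cannot help, but `t + β t ^ (P + 1)` interacts with
`a t ^ (2 k + 1)` and changes the coefficient of degree `n + 1` by `β a (P - 2 k)`. This fails only
for `P = 2 k`, that is `n = 4 k`. -/
theorem NearConj.succ_of_ne_four_mul {n k : ℕ} {h g : ℝ → ℝ} {a : ℝ} (ha : AnalyticAt ℝ h 0)
    (h0 : h 0 = 0) (hg : AnalyticAt ℝ g 0) (ha0 : a ≠ 0) (hk : 1 ≤ k)
    (hga : (fun t => g t - -1 * t - a * t ^ (2 * k + 1)) =o[𝓝 0] (fun t => t ^ (2 * k + 1)))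
    (hn1 : 2 * k + 1 ≤ n) (hne : n ≠ 4 * k) (hn : NearConj n h g) : NearConj (n + 1) h g := by
  have hg1 : (fun t => g t - -1 * t) =o[𝓝 0] (fun t => t) := by
    have h2 : (fun t : ℝ => a * t ^ (2 * k + 1)) =o[𝓝 0] (fun t => t) := by
      simpa using (isLittleO_pow_pow (𝕜 := ℝ) (show 1 < 2 * k + 1 by omega)).const_mul_left a
    have h3 : (fun t : ℝ => t ^ (2 * k + 1)) =O[𝓝 0] (fun t => t) := by
      simpa using isBigO_pow_pow (show 1 ≤ 2 * k + 1 by omega)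
    exact ((hga.trans_isBigO h3).add h2).congr_left fun t => by ring
  rcases Nat.even_or_odd n with hev | hodd
  swap
  -- For odd `n` the degree `n + 1` is even and not resonant with multiplier `-1`.
  · refine hn.succ_of_pow_ne ha h0 hg hg1 (by omega) ?_
    rw [hodd.add_one.neg_one_pow]; norm_num
  obtain ⟨P, rfl⟩ := Nat.exists_eq_add_of_le (show 2 * k ≤ n by omega)
  have hP : Even P := by
    rw [Nat.even_add] at hev
    exact hev.1 (even_two_mul k)
  have hP1 : 1 ≤ P := by omega
  refine hn.succ_of_forall ha h0 fun f hf _ hfg => ?_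
  obtain ⟨d, hd⟩ := (hf.sub hg).exists_leading_coeff hfg
  obtain ⟨β, hβ⟩ : ∃ β : ℝ, d + β * ((P + 1) * a) - a * ((2 * k + 1) * β) = 0 := by
    have h1 : (2 * k - P : ℝ) ≠ 0 := by
      rw [sub_ne_zero]
      intro h
      have : 2 * k = P := by exact_mod_cast h
      omega
    refine ⟨d / (a * (2 * k - P)), ?_⟩
    field_simp
    ring
  have h1 := hasDerivAt_id_add_mul_pow β (show 2 ≤ P + 1 by omega)
  have ht := tendsto_zero_of_hasDerivAt (by simp) h1
  refine NearConj.of_comp_sub_comp (φ := fun t => t + β * t ^ (P + 1)) (by fun_prop) (by simp)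
    h1 ?_
  have hfa : (fun t => f t - -1 * t - a * t ^ (2 * k + 1)) =o[𝓝 0] (fun t => t ^ (2 * k + 1)) :=
    ((hfg.trans_isBigO (isBigO_pow_pow hn1)).add hga).congr_left fun t => by ring
  have e2 := isLittleO_pow_expansion (by omega) hfa P
  have hχ : ∀ j : ℕ, (fun t : ℝ => (t + β * t ^ (P + 1)) ^ (j + 1) - t ^ (j + 1)
      - (j + 1) * β * t ^ (j + 1 + P)) =o[𝓝 0] (fun t => t ^ (j + 1 + P)) := fun j => by
    have := isLittleO_pow_expansion (f := fun t : ℝ => t + β * t ^ (P + 1)) (s := 1) (a := β)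
      (l := P) hP1 (by simp) j
    simpa using this
  have e3 := hχ (2 * k)
  have hr : AnalyticAt ℝ (fun t => g t - -1 * t - a * t ^ (2 * k + 1)) 0 := by fun_prop
  -- The tail of `g` is `t ^ (2 k + 2) q`; the coordinate change alters it only beyond degree `2 k +
  -- P + 1`.
  obtain ⟨q, hq, hrq⟩ := hr.exists_eq_pow_mul hga
  have e4 : (fun t : ℝ => (t + β * t ^ (P + 1)) ^ (2 * k + 1 + 1) * q (t + β * t ^ (P + 1))
      - t ^ (2 * k + 1 + 1) * q t) =o[𝓝 0] (fun t => t ^ (2 * k + P + 1)) := by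
    have hlt : (fun t : ℝ => t ^ (2 * k + 1 + 1 + P)) =o[𝓝 0] (fun t => t ^ (2 * k + P + 1)) :=
      isLittleO_pow_pow (by omega)
    have o1 : (fun t : ℝ => (t + β * t ^ (P + 1)) ^ (2 * k + 1 + 1) - t ^ (2 * k + 1 + 1))
        =O[𝓝 0] (fun t => t ^ (2 * k + 1 + 1 + P)) :=
      ((hχ (2 * k + 1)).isBigO.add ((isBigO_refl _ _).const_mul_left
        (((2 * k + 1 : ℕ) + 1) * β))).congr_left fun t => by ring
    have o2 : q =O[𝓝 0] (fun _ => (1 : ℝ)) := hq.continuousAt.tendsto.isBigO_one ℝ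
    have o3 : (fun t : ℝ => (t + β * t ^ (P + 1)) ^ (2 * k + 1 + 1))
        =O[𝓝 0] (fun t => t ^ (2 * k + 1 + 1)) := (isBigO_id_of_hasDerivAt (by simp) h1).pow _
    have o4 : (fun t : ℝ => q (t + β * t ^ (P + 1)) - q t) =O[𝓝 0] (fun t => t ^ (P + 1)) := by
      have := hq.hasStrictDerivAt.isBigO_sub.comp_tendsto
        (k := fun t : ℝ => (t + β * t ^ (P + 1), t)) (ht.prodMk_nhds tendsto_id)
      refine (this.congr_right fun t => ?_).trans
        ((isBigO_refl (fun t : ℝ => t ^ (P + 1)) (𝓝 0)).const_mul_left β)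
      simp
    have hlt2 : (fun t : ℝ => t ^ (2 * k + 1 + 1) * t ^ (P + 1))
        =o[𝓝 0] (fun t => t ^ (2 * k + P + 1)) := by
      simp only [← pow_add]
      exact isLittleO_pow_pow (by omega)
    refine (((o1.mul o2).trans_isLittleO (by simpa using hlt)).add
      ((o3.mul o4).trans_isLittleO hlt2)).congr_left fun t => ?_
    ring
  have e2' : (fun t => β * (f t ^ (P + 1) + t ^ (P + 1) - (P + 1) * a * t ^ (2 * k + P + 1)))
      =o[𝓝 0] (fun t => t ^ (2 * k + P + 1)) := by
    refine (e2.const_mul_left β).congr (fun t => ?_) fun t => by ring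
    -- As `P + 1` is odd, the terms `β t ^ (P + 1)` of the two sides cancel.
    rw [hP.neg_one_pow, hP.add_one.neg_one_pow]; ring
  have e3' : (fun t => a * ((t + β * t ^ (P + 1)) ^ (2 * k + 1) - t ^ (2 * k + 1)
      - (2 * k + 1) * β * t ^ (2 * k + P + 1))) =o[𝓝 0] (fun t => t ^ (2 * k + P + 1)) :=
    (e3.const_mul_left a).congr (fun t => by push_cast; ring) fun t => by ring
  refine (((hd.add e2').sub e3').sub e4).congr' ?_ .rfl
  filter_upwards [hrq, ht.eventually hrq] with t h2 h3
  simp only [Pi.sub_apply]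
  rw [← h2, ← h3]
  linear_combination (-(t ^ (2 * k + P + 1))) * hβ

/-! ### Formal normal forms -/

/-- A resonance `(-lam) ^ (n + 1) = 1` would give `lam = 1` on taking absolute values. -/
theorem nearConj_linear {h : ℝ → ℝ} {lam : ℝ} (hlam : 0 < lam) (h1 : lam ≠ 1)
    (ha : AnalyticAt ℝ h 0) (hh : (fun t => h t - (-lam * t)) =o[𝓝 0] (fun t => t)) (n : ℕ) :
    NearConj n h (fun t => -lam * t) := by
  have h0 := (isLittleO_sub_mul_id_iff.1 hh).1
  suffices H : ∀ n, NearConj (n + 1) h (fun t => -lam * t) from (H n).mono n.le_succ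
  intro n
  induction n with
  | zero => exact .of_isLittleO (by simpa using hh)
  | succ n ih =>
    refine ih.succ_of_pow_ne (a := -lam) ha h0 (by fun_prop) (by simp) (by omega) fun he => ?_
    have h2 : (-lam) ^ (n + 1) = 1 := by
      refine mul_right_cancel₀ (neg_ne_zero.2 hlam.ne') ?_
      rw [← pow_succ, he, one_mul]
    have h3 : lam ^ (n + 1) = 1 := by
      have := congrArg abs h2
      rwa [abs_pow, abs_neg, abs_of_pos hlam, abs_one] at this
    exact h1 ((pow_eq_one_iff_of_nonneg hlam.le (by omega)).1 h3)

/-- A germ `-t + o(t)` is conjugate to `-t` to every finite order, or a resonant term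
`a t ^ (2 k + 1)` comes first. -/
theorem nearConj_neg_or_resonant {h : ℝ → ℝ} (ha : AnalyticAt ℝ h 0)
    (hh : (fun t => h t - -1 * t) =o[𝓝 0] (fun t => t)) :
    (∀ n, NearConj n h (fun t => -1 * t)) ∨
    ∃ k : ℕ, 1 ≤ k ∧ ∃ a : ℝ, a ≠ 0 ∧ ∃ φ ψ, IsGermCoord φ ψ ∧
      (fun t => φ (h (ψ t)) - -1 * t - a * t ^ (2 * k + 1)) =o[𝓝 0]
        (fun t => t ^ (2 * k + 1)) := by
  have h0 := (isLittleO_sub_mul_id_iff.1 hh).1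
  by_contra! hcon
  obtain ⟨⟨n, hn⟩, hcon⟩ := hcon
  suffices H : ∀ n, NearConj (n + 1) h (fun t => -1 * t) from hn ((H n).mono n.le_succ)
  intro n
  induction n with
  | zero => exact .of_isLittleO (by simpa using hh)
  | succ n ih =>
    rcases Nat.even_or_odd (n + 1) with ⟨k, hk⟩ | hodd
    · obtain ⟨φ, ψ, hc, hs⟩ := id ih
      have hf : AnalyticAt ℝ (fun t => φ (h (ψ t))) 0 :=
        hc.analyticAt_conj ha h0
      obtain ⟨d, hd⟩ := (hf.sub (show AnalyticAt ℝ (fun t : ℝ => -1 * t) 0 by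
        fun_prop)).exists_leading_coeff hs
      rw [hk, ← two_mul] at hd
      -- A nonzero `d` would be the excluded first resonant term, so the same coordinate works one
      -- order further.
      have hd0 : d = 0 := by
        by_contra hd0
        exact hcon k (by omega) d hd0 φ ψ hc hd
      refine ⟨φ, ψ, hc, ?_⟩
      rw [hk, ← two_mul]
      simpa [hd0] using hd
    · refine ih.succ_of_pow_ne (a := -1) ha h0 (by fun_prop) (by simp) (by omega) ?_
      rw [hodd.add_one.neg_one_pow]; norm_num

/-- In a family of germs `-t + a t ^ (2 k + 1) + o(t ^ (2 k + 1))` with an arbitrary coefficient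
at `t ^ (4 k + 1)` every germ of this kind has a representative up to formal equivalence. -/
theorem exists_nearConj_of_family {f g₀ : ℝ → ℝ} {a : ℝ} {k : ℕ} {G : Set (ℝ → ℝ)}
    (hf : AnalyticAt ℝ f 0) (ha0 : a ≠ 0) (hk : 1 ≤ k)
    (hfa : (fun t => f t - -1 * t - a * t ^ (2 * k + 1)) =o[𝓝 0] (fun t => t ^ (2 * k + 1)))
    (hg₀ : AnalyticAt ℝ g₀ 0)
    (hga : (fun t => g₀ t - -1 * t - a * t ^ (2 * k + 1)) =o[𝓝 0] (fun t => t ^ (2 * k + 1)))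
    (H : ∀ d : ℝ, ∃ g ∈ G, AnalyticAt ℝ g 0 ∧
      (fun t => g t - g₀ t - d * t ^ (4 * k + 1)) =o[𝓝 0] (fun t => t ^ (4 * k + 1))) :
    ∃ g ∈ G, ∀ n, NearConj n f g := by
  have h0 : f 0 = 0 := by
    have := (hfa.bound (c := 1) one_pos).self_of_nhds
    simpa using this
  -- Degrees `2 k + 2` to `4 k` are cleared against `g₀`; the discrepancy `d` left in degree `4 k +
  -- 1` selects the member of the family.
  have h1 : ∀ j, 2 * k + 1 + j ≤ 4 * k → NearConj (2 * k + 1 + j) f g₀ := by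
    intro j
    induction j with
    | zero => exact fun _ => .of_isLittleO ((hfa.sub hga).congr_left fun t => by simp)
    | succ j ih =>
      exact fun hj => (ih (by omega)).succ_of_ne_four_mul (n := 2 * k + 1 + j) hf h0 hg₀ ha0 hk hga (by omega) (by omega)
  have h2 : NearConj (4 * k) f g₀ := by
    have := h1 (2 * k - 1) (by omega)
    rwa [show 2 * k + 1 + (2 * k - 1) = 4 * k by omega] at this
  obtain ⟨φ, ψ, hc, hs⟩ := h2
  have hf' : AnalyticAt ℝ (fun t => φ (f (ψ t))) 0 :=
    hc.analyticAt_conj hf h0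
  obtain ⟨d, hd⟩ := (hf'.sub hg₀).exists_leading_coeff hs
  obtain ⟨g, hgG, hg, hgd⟩ := H d
  have hga' : (fun t => g t - -1 * t - a * t ^ (2 * k + 1)) =o[𝓝 0] (fun t => t ^ (2 * k + 1)) := by
    have h3 : (fun t => g t - g₀ t) =o[𝓝 0] (fun t => t ^ (2 * k + 1)) := by
      refine IsBigO.trans_isLittleO (g := fun t : ℝ => t ^ (4 * k + 1)) ?_
        (isLittleO_pow_pow (by omega))
      exact (hgd.isBigO.add ((isBigO_refl _ _).const_mul_left d)).congr_left fun t => by ring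
    exact (h3.add hga).congr_left fun t => by ring
  have h4 : NearConj (4 * k + 1) f g :=
    ⟨φ, ψ, hc, (hd.sub hgd).congr_left fun t => by simp only [Pi.sub_apply]; ring⟩
  refine ⟨g, hgG, fun n => ?_⟩
  suffices H : ∀ j, NearConj (4 * k + 1 + j) f g from (H n).mono (by omega)
  intro j
  induction j with
  | zero => exact h4
  | succ j ih =>
    exact ih.succ_of_ne_four_mul (n := 4 * k + 1 + j) hf h0 hg ha0 hk hga' (by omega) (by omega)

/-! ### From half-turns to semi-monodromy maps -/

/-- The planar field whose polar equations are `r' = A r`, `θ' = B`. -/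
def polarField (A B : ℝ × ℝ → ℝ) (p : ℝ × ℝ) : ℝ × ℝ :=
  (A p * p.1 - B p * p.2, A p * p.2 + B p * p.1)

/-- In (signed) polar coordinates, the orbit of `polarField A B` through `(t, 0)` makes half a turn,
ends at `(q, 0)` and stays within distance `C |t|` of the origin. -/
def IsHalfTurn (A B : ℝ × ℝ → ℝ) (C t q : ℝ) : Prop :=
  ∃ (T : ℝ) (R Θ : ℝ → ℝ), 0 < T ∧ R 0 = t ∧ Θ 0 = 0 ∧ R T = -q ∧ Θ T = Real.pi ∧
    ∀ s ∈ Icc 0 T,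
      HasDerivAt R (A (R s * Real.cos (Θ s), R s * Real.sin (Θ s)) * R s) s ∧
      HasDerivAt Θ (B (R s * Real.cos (Θ s), R s * Real.sin (Θ s))) s ∧
      0 < B (R s * Real.cos (Θ s), R s * Real.sin (Θ s)) ∧ R s ≠ 0 ∧ |R s| ≤ C * |t|

/-- The field `polarField A B` in the coordinates `(x, y)` with `(φ x, y)` as the old ones. -/
noncomputable def pulledField (A B : ℝ × ℝ → ℝ) (φ : ℝ → ℝ) (p : ℝ × ℝ) : ℝ × ℝ :=
  ((polarField A B (φ p.1, p.2)).1 * (deriv φ p.1)⁻¹, (polarField A B (φ p.1, p.2)).2)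

/-- The characteristic polynomial is `(z - α) ^ 2 + 1`, positive on the real line. -/
theorem im_ne_zero_of_aeval_charpoly {α : ℝ} {L : ℝ × ℝ →ₗ[ℝ] ℝ × ℝ}
    (hL : ∀ p, L p = (α * p.1 - p.2, α * p.2 + p.1)) {z : ℂ}
    (hz : Polynomial.aeval z L.charpoly = 0) : z.im ≠ 0 := by
  intro him
  have hM : LinearMap.toMatrix (Module.Basis.finTwoProd ℝ) (Module.Basis.finTwoProd ℝ) L
      = !![α, -1; 1, α] := by
    ext i j
    fin_cases i <;> fin_cases j <;> simp [LinearMap.toMatrix_apply, hL]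
  rw [← LinearMap.charpoly_toMatrix L (Module.Basis.finTwoProd ℝ), hM,
    Matrix.charpoly_fin_two] at hz
  simp [Matrix.trace_fin_two, Matrix.det_fin_two] at hz
  obtain ⟨x, rfl⟩ : ∃ x : ℝ, z = x := ⟨z.re, by apply Complex.ext <;> simp [him]⟩
  have hx : x ^ 2 - (α + α) * x + (α * α + 1) = 0 := by exact_mod_cast hz
  nlinarith [sq_nonneg (x - α)]

theorem HasFDerivAt.mul_of_zero {u l : ℝ × ℝ → ℝ} {l' : ℝ × ℝ →L[ℝ] ℝ} {x : ℝ × ℝ}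
    (hu : DifferentiableAt ℝ u x) (hl : HasFDerivAt l l' x) (h0 : l x = 0) :
    HasFDerivAt (fun p => u p * l p) (u x • l') x := by
  simpa [h0] using hu.hasFDerivAt.fun_mul hl

section Realization

variable {A B : ℝ × ℝ → ℝ} {φ ψ M : ℝ → ℝ}

theorem analyticAt_pulledField (hA : AnalyticOnNhd ℝ A univ) (hB : AnalyticOnNhd ℝ B univ)
    {p : ℝ × ℝ} (hφ : AnalyticAt ℝ φ p.1) (hd : deriv φ p.1 ≠ 0) :
    AnalyticAt ℝ (pulledField A B φ) p := by
  have h1 : AnalyticAt ℝ (fun p : ℝ × ℝ => φ p.1) p := hφ.fun_comp analyticAt_fst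
  have h2 : AnalyticAt ℝ (fun p : ℝ × ℝ => (φ p.1, p.2)) p := h1.prod analyticAt_snd
  have h3 : AnalyticAt ℝ (fun p : ℝ × ℝ => A (φ p.1, p.2)) p :=
    AnalyticAt.fun_comp (hA _ (mem_univ _)) h2
  have h4 : AnalyticAt ℝ (fun p : ℝ × ℝ => B (φ p.1, p.2)) p :=
    AnalyticAt.fun_comp (hB _ (mem_univ _)) h2
  have h5 : AnalyticAt ℝ (fun p : ℝ × ℝ => (deriv φ p.1)⁻¹) p :=
    (AnalyticAt.fun_comp hφ.deriv analyticAt_fst).inv hd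
  have h6 : AnalyticAt ℝ (fun p : ℝ × ℝ => p.2) p := analyticAt_snd
  exact (((h3.mul h1).sub (h4.mul h6)).mul h5).prod ((h3.mul h6).add (h4.mul h1))

theorem isNondegenerateMonodromic_pulledField (hA : AnalyticOnNhd ℝ A univ)
    (hB : AnalyticOnNhd ℝ B univ) (hB0 : B 0 = 1) (hc : IsGermCoord φ ψ) :
    IsNondegenerateMonodromic (pulledField A B φ) := by
  refine ⟨by simp [pulledField, polarField, hc.map_zero], fun z hz => ?_⟩
  have h1 : HasFDerivAt (fun p : ℝ × ℝ => φ p.1) (ContinuousLinearMap.fst ℝ ℝ ℝ) 0 := by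
    have := HasFDerivAt.comp (0 : ℝ × ℝ) (g := φ) hc.hasDerivAt.hasFDerivAt
      (hasFDerivAt_fst (𝕜 := ℝ) (E := ℝ) (F := ℝ))
    refine this.congr_fderiv ?_
    ext <;> simp
  have h2 : HasFDerivAt (fun p : ℝ × ℝ => p.2) (ContinuousLinearMap.snd ℝ ℝ ℝ) 0 :=
    hasFDerivAt_snd
  have hΦ : DifferentiableAt ℝ (fun p : ℝ × ℝ => (φ p.1, p.2)) 0 :=
    h1.differentiableAt.prodMk h2.differentiableAt
  have hdA : DifferentiableAt ℝ (fun p : ℝ × ℝ => A (φ p.1, p.2)) 0 :=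
    DifferentiableAt.fun_comp' (0 : ℝ × ℝ) (hA _ (mem_univ _)).differentiableAt hΦ
  have hdB : DifferentiableAt ℝ (fun p : ℝ × ℝ => B (φ p.1, p.2)) 0 :=
    DifferentiableAt.fun_comp' (0 : ℝ × ℝ) (hB _ (mem_univ _)).differentiableAt hΦ
  have hdI : DifferentiableAt ℝ (fun p : ℝ × ℝ => (deriv φ p.1)⁻¹) 0 :=
    ((AnalyticAt.fun_comp (g := deriv φ) (f := Prod.fst) (x := (0 : ℝ × ℝ)) hc.analytic.deriv
      analyticAt_fst).inv (by simp [hc.hasDerivAt.deriv])).differentiableAt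
  have hB0' : B (φ (0 : ℝ × ℝ).1, (0 : ℝ × ℝ).2) = 1 := by
    rw [← hB0]; simp [hc.map_zero]; rfl
  have hφ0 : φ (0 : ℝ × ℝ).1 = 0 := hc.map_zero
  have hI0 : (deriv φ (0 : ℝ × ℝ).1)⁻¹ = 1 := by simp [hc.hasDerivAt.deriv]
  -- Every product here has a factor vanishing at the origin, so only the derivative of that factor
  -- contributes.
  have hV := (HasFDerivAt.mul_of_zero hdI ((HasFDerivAt.mul_of_zero hdA h1 hφ0).sub
      (HasFDerivAt.mul_of_zero hdB h2 rfl)) (by simp [hc.map_zero])).prodMk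
    ((HasFDerivAt.mul_of_zero hdA h2 rfl).add (HasFDerivAt.mul_of_zero hdB h1 hφ0))
  have hV' : HasFDerivAt (pulledField A B φ) _ 0 := hV.congr_of_eventuallyEq
    (.of_forall fun p => by simp [pulledField, polarField, mul_comm])
  rw [hV'.fderiv] at hz
  refine im_ne_zero_of_aeval_charpoly (α := A (φ (0 : ℝ × ℝ).1, (0 : ℝ × ℝ).2)) (fun p => ?_) hz
  simp only [hB0', hI0, one_smul]
  simp

theorem IsGermCoord.eventually_hasDerivAt_inv (hc : IsGermCoord φ ψ) :
    ∀ᶠ w in 𝓝 0, HasDerivAt ψ (deriv φ (ψ w))⁻¹ w := by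
  filter_upwards [hc.analytic_inv.eventually_analyticAt,
    hc.symm.tendsto.eventually hc.analytic.eventually_analyticAt,
    hc.right_inv.eventually_nhds] with w h1 h2 h3
  have h4 := h2.differentiableAt.hasDerivAt.comp w h1.differentiableAt.hasDerivAt
  have h5 : HasDerivAt (φ ∘ ψ) 1 w := (hasDerivAt_id w).congr_of_eventuallyEq h3
  have h6 := h4.unique h5
  rw [← eq_inv_of_mul_eq_one_right h6]
  exact h1.differentiableAt.hasDerivAt

/-- Applying `ψ` to the abscissa carries the orbit to one of the new field. Since `Θ' = B > 0`, the
angle increases from `0` to `π`, so `R sin Θ` has no zero strictly in between. -/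
theorem IsHalfTurn.isFirstIntersection {C t q η δ : ℝ} {U : Set (ℝ × ℝ)}
    (h : IsHalfTurn A B C t q) (hCt : C * |t| < η)
    (hη : ∀ w, |w| < η → φ (ψ w) = w ∧ HasDerivAt ψ (deriv φ (ψ w))⁻¹ w ∧ ∀ y, (ψ w, y) ∈ U)
    (hq : ψ q ∈ Ioo (-δ) δ) :
    IsFirstIntersection U (pulledField A B φ) ((fun t => (t, (0 : ℝ))) '' Ioo (-δ) δ)
      (ψ t, 0) (ψ q, 0) := by
  obtain ⟨T, R, Θ, hT, hR0, hΘ0, hRT, hΘT, h⟩ := h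
  have hη' : ∀ s ∈ Icc 0 T, |R s * Real.cos (Θ s)| < η := fun s hs => by
    refine lt_of_le_of_lt ?_ ((h s hs).2.2.2.2.trans_lt hCt)
    rw [abs_mul]
    exact mul_le_of_le_one_right (abs_nonneg _) (Real.abs_cos_le_one _)
  have hmono : StrictMonoOn Θ (Icc 0 T) := by
    refine strictMonoOn_of_deriv_pos (convex_Icc _ _)
      (fun s hs => (h s hs).2.1.continuousAt.continuousWithinAt) fun s hs => ?_
    rw [interior_Icc] at hs
    obtain ⟨-, h1, h2, -⟩ := h s (Ioo_subset_Icc_self hs)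
    rwa [h1.deriv]
  refine ⟨T, fun s => (ψ (R s * Real.cos (Θ s)), R s * Real.sin (Θ s)), hT, fun s hs => ?_,
    fun s hs => (hη _ (hη' s hs)).2.2 _, by simp [hR0, hΘ0], fun s hs => ?_,
    by simp [hRT, hΘT], mem_image_of_mem _ hq⟩
  · obtain ⟨hR, hΘ, -⟩ := h s hs
    obtain ⟨h1, h2, -⟩ := hη _ (hη' s hs)
    have hx := hR.fun_mul hΘ.cos
    have hy := hR.fun_mul hΘ.sin
    refine HasDerivAt.hasDerivWithinAt (((h2.comp s hx).prodMk hy).congr_deriv ?_)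
    simp only [pulledField, polarField, h1, Prod.mk.injEq]
    constructor <;> ring
  · rintro ⟨x, -, hx⟩
    have hs' := Ioo_subset_Icc_self hs
    have h0 : R s * Real.sin (Θ s) = 0 := (congrArg Prod.snd hx).symm
    have h1 : 0 < Θ s := hΘ0 ▸ hmono (left_mem_Icc.2 hT.le) hs' hs.1
    have h2 : Θ s < Real.pi := hΘT ▸ hmono hs' (right_mem_Icc.2 hT.le) hs.2
    exact mul_ne_zero (h s hs').2.2.2.1 (Real.sin_pos_of_pos_of_lt_pi h1 h2).ne' h0

/-- If the half-turn map of `polarField A B` is `M`, then in the new coordinates the field has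
the conjugate of `M` as its semi-monodromy map. -/
theorem exists_field_of_isHalfTurn {C : ℝ} (hA : AnalyticOnNhd ℝ A univ)
    (hB : AnalyticOnNhd ℝ B univ) (hB0 : B 0 = 1) (hM : AnalyticAt ℝ M 0) (hM0 : M 0 = 0)
    (hM1 : deriv M 0 < 0) (hturn : ∀ᶠ t in 𝓝 0, t ≠ 0 → IsHalfTurn A B C t (M t))
    (hc : IsGermCoord φ ψ) :
    ∃ (U : Set (ℝ × ℝ)) (V : ℝ × ℝ → ℝ × ℝ), IsOpen U ∧ (0 : ℝ × ℝ) ∈ U ∧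
      AnalyticOnNhd ℝ V U ∧ IsNondegenerateMonodromic V ∧
      ∀ δ : ℝ, 0 < δ → IsSemiMonodromy U V (fun t => (t, 0)) δ (fun t => ψ (M (φ t))) := by
  have hm := hc.symm.analyticAt_conj hM hM0
  have hm0 : ψ (M (φ 0)) = 0 := by rw [hc.map_zero, hM0, hc.map_zero_inv]
  have hm1 : deriv (fun t => ψ (M (φ t))) 0 = deriv M 0 := by
    have h1 : HasDerivAt (fun t => M (φ t)) (deriv M 0 * 1) 0 :=
      HasDerivAt.comp 0 (h₂ := M) (by rw [hc.map_zero]; exact hM.differentiableAt.hasDerivAt)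
        hc.hasDerivAt
    have h2 : HasDerivAt (fun t => ψ (M (φ t))) (1 * (deriv M 0 * 1)) 0 :=
      HasDerivAt.comp 0 (h₂ := ψ) (by rw [hc.map_zero, hM0]; exact hc.hasDerivAt_inv) h1
    simpa using h2.deriv
  have hU : ∀ᶠ x in 𝓝 0, AnalyticAt ℝ φ x ∧ deriv φ x ≠ 0 :=
    hc.analytic.eventually_analyticAt.and
      (hc.analytic.deriv.continuousAt.eventually_ne (by simp [hc.hasDerivAt.deriv]))
  obtain ⟨r, hr, hrU⟩ := Metric.eventually_nhds_iff.1 hU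
  -- A vertical strip suffices: the change of coordinates restricts only the abscissa.
  refine ⟨{p | |p.1| < r}, pulledField A B φ, isOpen_lt (by fun_prop) continuous_const,
    by simpa using hr, fun p hp => ?_, isNondegenerateMonodromic_pulledField hA hB hB0 hc,
    fun δ hδ => ?_⟩
  · obtain ⟨h1, h2⟩ := hrU (y := p.1) (by simpa using hp)
    exact analyticAt_pulledField hA hB h1 h2
  · have hηev : ∀ᶠ w in 𝓝 0, φ (ψ w) = w ∧ HasDerivAt ψ (deriv φ (ψ w))⁻¹ w ∧ |ψ w| < r := by
      refine hc.right_inv.and (hc.eventually_hasDerivAt_inv.and ?_)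
      filter_upwards [hc.symm.tendsto.eventually (Metric.ball_mem_nhds (0 : ℝ) hr)] with w hw
      simpa using hw
    obtain ⟨η, hη, hηw⟩ := Metric.eventually_nhds_iff.1 hηev
    have hev : ∀ᶠ t in 𝓝 0, AnalyticAt ℝ (fun t => ψ (M (φ t))) t ∧
        ψ (M (φ t)) ∈ Ioo (-δ) δ ∧ ψ (φ t) = t ∧
        (φ t ≠ 0 → IsHalfTurn A B C (φ t) (M (φ t))) ∧ C * |φ t| < η := by
      refine hm.eventually_analyticAt.and (Eventually.and ?_ (hc.left_inv.and
        ((hc.tendsto.eventually hturn).and ?_)))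
      · refine hm.continuousAt.eventually (Ioo_mem_nhds ?_ ?_) <;> simp [hm0, hδ]
      · have : Tendsto (fun t => C * |φ t|) (𝓝 0) (𝓝 0) := by
          simpa using hc.tendsto.abs.const_mul C
        exact this.eventually (gt_mem_nhds hη)
    obtain ⟨ε, hε, hεt⟩ := Metric.eventually_nhds_iff.1 hev
    have hlt : ∀ t ∈ Ioo (-(min ε (δ / 2))) (min ε (δ / 2)), dist t 0 < ε := fun t ht => by
      rw [Real.dist_eq, sub_zero]
      exact (abs_lt.2 ht).trans_le (min_le_left _ _)
    refine ⟨min ε (δ / 2), lt_min hε (half_pos hδ),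
      (min_le_right _ _).trans_lt (half_lt_self hδ), fun t ht => (hεt (hlt t ht)).1,
      fun t ht => (hεt (hlt t ht)).2.1, hm0, hm1 ▸ hM1, fun t ht ht0 => ?_⟩
    obtain ⟨-, h2, h3, h4, h5⟩ := hεt (hlt t ht)
    have hφ0 : φ t ≠ 0 := fun h => ht0 (by rw [← h3, h, hc.map_zero_inv])
    have := (h4 hφ0).isFirstIntersection (φ := φ) (ψ := ψ) (U := {p | |p.1| < r}) (δ := δ) h5
      (fun w hw => by
        obtain ⟨a, b, c⟩ := hηw (y := w) (by simpa using hw)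
        exact ⟨a, b, fun _ => c⟩) h2
    rwa [h3] at this

end Realization

/-! ### Explicit fields and their half-turn germs -/

/-- The angle runs at unit speed, so the radius grows at rate `log lam / π` for a time `π` and is
multiplied by `lam`. -/
theorem isHalfTurn_linear {lam : ℝ} (hlam : 0 < lam) {t : ℝ} (ht : t ≠ 0) :
    IsHalfTurn (fun _ => Real.log lam / Real.pi) (fun _ => 1)
      (Real.exp |Real.log lam|) t (-lam * t) := by
  refine ⟨Real.pi, fun s => t * Real.exp (Real.log lam / Real.pi * s), fun s => s, Real.pi_pos,
    by simp, rfl, ?_, rfl, fun s hs => ⟨?_, hasDerivAt_id' s, one_pos,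
      mul_ne_zero ht (Real.exp_pos _).ne', ?_⟩⟩
  · simp only [div_mul_cancel₀ _ Real.pi_ne_zero, Real.exp_log hlam]; ring
  · have h := ((hasDerivAt_id' s).const_mul (Real.log lam / Real.pi)).exp.const_mul t
    exact h.congr_deriv (by ring)
  · rw [abs_mul, mul_comm, Real.abs_exp]
    refine mul_le_mul_of_nonneg_right (Real.exp_le_exp.2 ?_) (abs_nonneg t)
    refine (le_abs_self _).trans ?_
    rw [abs_mul, abs_div, abs_of_pos Real.pi_pos, abs_of_nonneg hs.1, div_mul_eq_mul_div]
    exact (div_le_iff₀ Real.pi_pos).2 (mul_le_mul_of_nonneg_left hs.2 (abs_nonneg _))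

/-- The germ `t ↦ -t (1 - κ w(t ^ (2 k))) ^ (-1 / (2 k))`. -/
noncomputable def spiralGerm (k : ℕ) (κ : ℝ) (w : ℝ → ℝ) (t : ℝ) : ℝ :=
  -t * (1 - κ * w (t ^ (2 * k))) ^ (-(1 / (2 * k : ℝ)))

/-- `w x = x T`, where `T` is the time of a half-turn of the field with polar equations
`r' = ε r ^ (2 k + 1)`, `θ' = 1 + c r ^ (2 k)` starting at `r ^ (2 k) = x`; here `κ = 2 k ε`. -/
structure IsHalfTurnTime (κ c : ℝ) (w : ℝ → ℝ) : Prop where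
  analytic : AnalyticAt ℝ w 0
  map_zero : w 0 = 0
  hasDerivAt : HasDerivAt w Real.pi 0
  eq : ∀ᶠ x in 𝓝 0, w x = x * (Real.pi + c / κ * Real.log (1 - κ * w x))

theorem analyticAt_log_one_sub (κ : ℝ) : AnalyticAt ℝ (fun x => Real.log (1 - κ * x)) 0 :=
  AnalyticAt.log (by fun_prop) (by simp)

/-- The implicit equation reads `w / D w = x`; as `D 0 = π`, the left side has derivative `1 / π` at
`0` and an analytic local inverse. -/
theorem exists_isHalfTurnTime (κ c : ℝ) : ∃ w, IsHalfTurnTime κ c w := by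
  set D : ℝ → ℝ := fun x => Real.pi + c / κ * Real.log (1 - κ * x) with hD
  have hDa : AnalyticAt ℝ D 0 := analyticAt_const.add (analyticAt_const.mul
    (analyticAt_log_one_sub κ))
  have hD0 : D 0 = Real.pi := by simp [hD]
  have hWa : AnalyticAt ℝ (fun x => x / D x) 0 :=
    analyticAt_id.div hDa (by simp [hD0, Real.pi_ne_zero])
  have hW1 : HasDerivAt (fun x => x / D x) Real.pi⁻¹ 0 := by
    have h := (hasDerivAt_id' (0 : ℝ)).fun_div hDa.differentiableAt.hasDerivAt
      (by simp [hD0, Real.pi_ne_zero])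
    refine h.congr_deriv ?_
    rw [hD0]
    field_simp
    simp
  have hd : deriv (fun x => x / D x) 0 ≠ 0 := by
    rw [hW1.deriv]; exact inv_ne_zero Real.pi_ne_zero
  have hs := hWa.hasStrictDerivAt
  have hw0 : hs.localInverse _ _ _ hd 0 = 0 := by
    simpa using (hs.eventually_left_inverse hd).self_of_nhds
  have hwa : AnalyticAt ℝ (hs.localInverse _ _ _ hd) 0 := by
    simpa using hWa.analyticAt_localInverse hd
  refine ⟨hs.localInverse _ _ _ hd, hwa, hw0, ?_, ?_⟩
  · simpa [hW1.deriv] using (hs.to_localInverse hd).hasDerivAt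
  · have h1 : ∀ᶠ x in 𝓝 0, D (hs.localInverse _ _ _ hd x) ≠ 0 :=
      ContinuousAt.eventually_ne (y := 0) (g := fun x => D (hs.localInverse _ _ _ hd x))
        (ContinuousAt.comp' (by rw [hw0]; exact hDa.continuousAt) hwa.continuousAt)
        (by simp [hw0, hD0, Real.pi_ne_zero])
    have h2 := hs.eventually_right_inverse hd
    rw [zero_div] at h2
    filter_upwards [h1, h2] with x h1 h2
    exact (div_eq_iff h1).1 h2

theorem isHalfTurnTime_zero (κ : ℝ) : IsHalfTurnTime κ 0 (fun x => Real.pi * x) where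
  analytic := by fun_prop
  map_zero := by simp
  hasDerivAt := by simpa using (hasDerivAt_id' (0 : ℝ)).const_mul Real.pi
  eq := .of_forall fun x => by ring

/-- Makes the smallness conditions on `w (t ^ (2 k))` hold for small `t`. -/
theorem IsHalfTurnTime.tendsto_pow {κ c : ℝ} {w : ℝ → ℝ} (hw : IsHalfTurnTime κ c w) {n : ℕ}
    (hn : n ≠ 0) : Tendsto (fun t : ℝ => w (t ^ n)) (𝓝 0) (𝓝 0) := by
  have h1 : Tendsto (fun t : ℝ => t ^ n) (𝓝 0) (𝓝 0) := by
    simpa [hn] using (continuous_pow n).tendsto (0 : ℝ)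
  exact (tendsto_zero_of_hasDerivAt hw.map_zero hw.hasDerivAt).comp h1

theorem analyticAt_one_sub_rpow (κ p : ℝ) : AnalyticAt ℝ (fun x => (1 - κ * x) ^ p) 0 := by
  refine (((analyticAt_log_one_sub κ).mul analyticAt_const).rexp (f := fun x =>
    Real.log (1 - κ * x) * p)).congr ?_
  have h : ContinuousAt (fun x : ℝ => 1 - κ * x) 0 := by fun_prop
  filter_upwards [h.eventually (lt_mem_nhds (show (0 : ℝ) < 1 - κ * 0 by simp))] with x hx
  rw [Real.rpow_def_of_pos hx]
  rfl

theorem hasStrictDerivAt_one_sub_rpow (κ p : ℝ) :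
    HasStrictDerivAt (fun x => (1 - κ * x) ^ p) (-κ * p) 0 := by
  have h1 : HasDerivAt (fun x => 1 - κ * x) (-κ) 0 := by
    simpa using ((hasDerivAt_id' (0 : ℝ)).const_mul κ).const_sub 1
  have h := (h1.rpow_const (p := p) (by simp)).deriv
  have h2 := (analyticAt_one_sub_rpow κ p).hasStrictDerivAt
  rw [h] at h2
  simpa using h2

section Spiral

variable {k : ℕ} {κ ε c : ℝ} {w : ℝ → ℝ}

theorem IsHalfTurnTime.analyticAt_factor (hw : IsHalfTurnTime κ c w) (hk : 1 ≤ k) (p : ℝ) :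
    AnalyticAt ℝ (fun t : ℝ => (1 - κ * w (t ^ (2 * k))) ^ p) 0 := by
  have h1 : AnalyticAt ℝ (fun t : ℝ => w (t ^ (2 * k))) 0 := by
    refine AnalyticAt.fun_comp ?_ (by fun_prop)
    rw [zero_pow (by omega)]
    exact hw.analytic
  exact AnalyticAt.fun_comp (g := fun x => (1 - κ * x) ^ p) (f := fun t : ℝ => w (t ^ (2 * k)))
    (by rw [zero_pow (by omega), hw.map_zero]; exact analyticAt_one_sub_rpow κ p) h1

theorem IsHalfTurnTime.analyticAt_spiralGerm (hw : IsHalfTurnTime κ c w) (hk : 1 ≤ k) :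
    AnalyticAt ℝ (spiralGerm k κ w) 0 :=
  analyticAt_id.neg.mul (hw.analyticAt_factor hk _)

theorem spiralGerm_zero : spiralGerm k κ w 0 = 0 := by simp [spiralGerm]

theorem IsHalfTurnTime.deriv_spiralGerm (hw : IsHalfTurnTime κ c w) (hk : 1 ≤ k) :
    deriv (spiralGerm k κ w) 0 = -1 := by
  have h := (hasDerivAt_neg' (0 : ℝ)).fun_mul
    (hw.analyticAt_factor hk (-(1 / (2 * k : ℝ)))).differentiableAt.hasDerivAt
  refine h.deriv.trans ?_
  simp [show k ≠ 0 by omega, hw.map_zero]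

theorem isLittleO_spiralGerm_leading (hk : 1 ≤ k) (hκ : κ = 2 * k * ε) :
    (fun t => spiralGerm k κ (fun x => Real.pi * x) t - -1 * t
      - -(ε * Real.pi) * t ^ (2 * k + 1)) =o[𝓝 0] (fun t => t ^ (2 * k + 1)) := by
  have hk0 : (k : ℝ) ≠ 0 := by exact_mod_cast (show k ≠ 0 by omega)
  have h := (hasStrictDerivAt_one_sub_rpow κ (-(1 / (2 * k : ℝ)))).hasDerivAt
  rw [hasDerivAt_iff_isLittleO] at h
  have h1 : Tendsto (fun t : ℝ => Real.pi * t ^ (2 * k)) (𝓝 0) (𝓝 0) :=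
    (isHalfTurnTime_zero κ).tendsto_pow (by omega)
  have h2 := (isBigO_refl (fun t : ℝ => -t) (𝓝 0)).mul_isLittleO (h.comp_tendsto h1)
  refine (h2.congr_left fun t => ?_).trans_isBigO
    (((isBigO_refl (fun t : ℝ => t ^ (2 * k + 1)) (𝓝 0)).const_mul_left (-Real.pi)).congr_left
      fun t => ?_)
  · simp only [Function.comp_apply, spiralGerm, smul_eq_mul, sub_zero, mul_zero, Real.one_rpow]
    subst hκ
    field_simp
    ring
  · simp only [Function.comp_apply]; ring

/-- From the implicit equation, `w x = π x - c π x ^ 2 + o(x ^ 2)`. The outer power has slope `ε` at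
`0`, and the factor `-t` turns `-ε c π x ^ 2` into the stated term at `x = t ^ (2 k)`. -/
theorem IsHalfTurnTime.isLittleO_spiralGerm_sub (hw : IsHalfTurnTime κ c w) (hk : 1 ≤ k)
    (hε : ε ≠ 0) (hκ : κ = 2 * k * ε) :
    (fun t => spiralGerm k κ w t - spiralGerm k κ (fun x => Real.pi * x) t
      - ε * c * Real.pi * t ^ (4 * k + 1)) =o[𝓝 0] (fun t => t ^ (4 * k + 1)) := by
  have hk0 : (k : ℝ) ≠ 0 := by exact_mod_cast (show k ≠ 0 by omega)
  have hκ0 : κ ≠ 0 := by rw [hκ]; positivity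
  have h1 : (fun x => Real.log (1 - κ * w x) - -(κ * Real.pi) * x) =o[𝓝 0] (fun x => x) := by
    refine isLittleO_sub_mul_id_iff.2 ⟨by simp [hw.map_zero], ?_⟩
    have := ((hw.hasDerivAt.const_mul κ).const_sub 1).log (by simp [hw.map_zero])
    simpa [hw.map_zero] using this
  have h2 : (fun x => w x - Real.pi * x + c * Real.pi * x ^ 2) =o[𝓝 0] (fun x => x ^ 2) := by
    have h3 := ((isBigO_refl (fun x : ℝ => x) (𝓝 0)).mul_isLittleO h1).const_mul_left (c / κ)
    refine h3.congr' ?_ (.of_forall fun x => by ring)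
    filter_upwards [hw.eq] with x hx
    rw [show w x - Real.pi * x = x * (c / κ * Real.log (1 - κ * w x)) by linear_combination hx]
    field_simp
    ring
  have h4 : (fun x => w x - Real.pi * x) =O[𝓝 0] (fun x => x ^ 2) :=
    (h2.isBigO.sub ((isBigO_refl (fun x : ℝ => x ^ 2) (𝓝 0)).const_mul_left
      (c * Real.pi))).congr_left fun x => by ring
  have hw0 := tendsto_zero_of_hasDerivAt hw.map_zero hw.hasDerivAt
  have hπ := tendsto_zero_of_hasDerivAt (isHalfTurnTime_zero κ).map_zero
    (isHalfTurnTime_zero κ).hasDerivAt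
  have h5 := (hasStrictDerivAt_one_sub_rpow κ
    (-(1 / (2 * k : ℝ)))).hasStrictFDerivAt.isLittleO.comp_tendsto
    (k := fun x => (w x, Real.pi * x)) (hw0.prodMk_nhds hπ)
  have h6 : (fun x => (1 - κ * w x) ^ (-(1 / (2 * k : ℝ)))
      - (1 - κ * (Real.pi * x)) ^ (-(1 / (2 * k : ℝ))) + ε * c * Real.pi * x ^ 2)
      =o[𝓝 0] (fun x => x ^ 2) := by
    refine ((h5.trans_isBigO h4).add (h2.const_mul_left ε)).congr_left fun x => ?_
    simp only [Function.comp_apply, ContinuousLinearMap.toSpanSingleton_apply, smul_eq_mul]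
    subst hκ
    field_simp
    ring
  have h7 : Tendsto (fun t : ℝ => t ^ (2 * k)) (𝓝 0) (𝓝 0) := by
    simpa [show k ≠ 0 by omega] using (continuous_pow (2 * k)).tendsto (0 : ℝ)
  have h8 := (isBigO_refl (fun t : ℝ => -t) (𝓝 0)).mul_isLittleO (h6.comp_tendsto h7)
  refine (h8.congr_left fun t => ?_).trans_isBigO
    (((isBigO_refl (fun t : ℝ => t ^ (4 * k + 1)) (𝓝 0)).const_mul_left (-1)).congr_left
      fun t => ?_)
  · simp only [Function.comp_apply, spiralGerm]; ring
  · simp only [Function.comp_apply]; ring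

theorem mul_rpow_pow_two_mul (hk : 1 ≤ k) (t : ℝ) {u : ℝ} (hu : 0 < u) :
    (t * u ^ (-(1 / (2 * k : ℝ)))) ^ (2 * k) = t ^ (2 * k) * u⁻¹ := by
  have hk0 : (k : ℝ) ≠ 0 := by exact_mod_cast (show k ≠ 0 by omega)
  rw [mul_pow, ← Real.rpow_natCast (u ^ _), ← Real.rpow_mul hu.le, ← Real.rpow_neg_one]
  congr 2
  push_cast
  field_simp

/-- Along orbits `r ^ (-2 k)` is affine in time, so `r ^ (2 k) = X / (1 - κ s X)`; integrating `1 +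
c r ^ (2 k)` gives the logarithm in the angle. -/
theorem IsHalfTurnTime.isHalfTurn (hw : IsHalfTurnTime κ c w) (hk : 1 ≤ k) (hε : ε ≠ 0)
    (hκ : κ = 2 * k * ε) : ∀ᶠ t in 𝓝 0, t ≠ 0 →
      IsHalfTurn (fun p => ε * (p.1 ^ 2 + p.2 ^ 2) ^ k) (fun p => 1 + c * (p.1 ^ 2 + p.2 ^ 2) ^ k)
        2 t (spiralGerm k κ w t) := by
  have hk0 : (k : ℝ) ≠ 0 := by exact_mod_cast (show k ≠ 0 by omega)
  have hκ0 : κ ≠ 0 := by rw [hκ]; positivity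
  have h7 : Tendsto (fun t : ℝ => t ^ (2 * k)) (𝓝 0) (𝓝 0) := by
    simpa [show k ≠ 0 by omega] using (continuous_pow (2 * k)).tendsto (0 : ℝ)
  have h8 := hw.tendsto_pow (show 2 * k ≠ 0 by omega)
  have e1 : ∀ᶠ t : ℝ in 𝓝 0, |κ * w (t ^ (2 * k))| < 1 / 2 := by
    have : Tendsto (fun t : ℝ => |κ * w (t ^ (2 * k))|) (𝓝 0) (𝓝 0) := by
      simpa using (h8.const_mul κ).abs
    exact this.eventually (gt_mem_nhds (by norm_num))
  have e2 : ∀ᶠ t : ℝ in 𝓝 0, 0 < Real.pi + c / κ * Real.log (1 - κ * w (t ^ (2 * k))) := by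
    have h9 : Tendsto (fun t : ℝ => Real.pi + c / κ * Real.log (1 - κ * w (t ^ (2 * k)))) (𝓝 0)
        (𝓝 Real.pi) := by
      have := ((analyticAt_log_one_sub κ).continuousAt.tendsto.comp h8).const_mul (c / κ)
      simpa using this.const_add Real.pi
    exact h9.eventually (lt_mem_nhds Real.pi_pos)
  have e3 : ∀ᶠ t : ℝ in 𝓝 0, 2 * (|c| * t ^ (2 * k)) < 1 := by
    have : Tendsto (fun t : ℝ => 2 * (|c| * t ^ (2 * k))) (𝓝 0) (𝓝 0) := by
      simpa using (h7.const_mul |c|).const_mul 2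
    exact this.eventually (gt_mem_nhds one_pos)
  filter_upwards [e1, e2, e3, h7.eventually hw.eq] with t e1 e2 e3 hwt ht
  have hX : 0 < t ^ (2 * k) := (even_two_mul k).pow_pos ht
  set X := t ^ (2 * k) with hXdef
  set T := Real.pi + c / κ * Real.log (1 - κ * w X) with hT
  -- For `0 ≤ s ≤ T` the quantity `s X` lies between `0` and `w X = X T`, so the bound at the final
  -- time controls the whole orbit.
  have hu : ∀ s ∈ Icc 0 T, 1 / 2 ≤ 1 - κ * (s * X) := fun s hs => by
    have h1 : |κ * (s * X)| ≤ |κ * w X| := by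
      rw [abs_mul, abs_mul κ, hwt]
      refine mul_le_mul_of_nonneg_left ?_ (abs_nonneg _)
      rw [abs_of_nonneg (mul_nonneg hs.1 hX.le), abs_of_nonneg (mul_nonneg hX.le e2.le),
        mul_comm X]
      exact mul_le_mul_of_nonneg_right hs.2 hX.le
    linarith [le_abs_self (κ * (s * X))]
  refine ⟨T, fun s => t * (1 - κ * (s * X)) ^ (-(1 / (2 * k : ℝ))),
    fun s => s - c / κ * Real.log (1 - κ * (s * X)), e2, by simp, by simp, ?_, ?_, fun s hs => ?_⟩
  · simp only [spiralGerm, ← hXdef]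
    rw [hwt, mul_comm T]; ring
  · simp only
    rw [mul_comm T X, ← hwt, hT]; ring
  have hus := hu s hs
  have hu0 : 0 < 1 - κ * (s * X) := by linarith
  have hρ : ∀ θ : ℝ, ((t * (1 - κ * (s * X)) ^ (-(1 / (2 * k : ℝ))) * Real.cos θ) ^ 2 +
      (t * (1 - κ * (s * X)) ^ (-(1 / (2 * k : ℝ))) * Real.sin θ) ^ 2) ^ k
      = X * (1 - κ * (s * X))⁻¹ := fun θ => by
    rw [mul_pow _ (Real.cos θ), mul_pow _ (Real.sin θ), ← mul_add, Real.cos_sq_add_sin_sq, mul_one, ← pow_mul,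
      mul_rpow_pow_two_mul hk t hu0]
  have hder : HasDerivAt (fun s => 1 - κ * (s * X)) (-(κ * X)) s := by
    simpa using (((hasDerivAt_id' s).mul_const X).const_mul κ).const_sub 1
  simp only [hρ]
  have hinv : (1 - κ * (s * X))⁻¹ ≤ 2 := by
    rw [inv_le_comm₀ hu0 two_pos]; linarith
  refine ⟨?_, ?_, ?_, mul_ne_zero ht (Real.rpow_pos_of_pos hu0 _).ne', ?_⟩
  · refine ((hder.rpow_const (p := -(1 / (2 * k : ℝ))) (.inl hu0.ne')).const_mul t).congr_deriv ?_
    rw [Real.rpow_sub_one hu0.ne', hκ]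
    rw [hκ] at hu0
    field_simp
  · refine ((hasDerivAt_id' s).sub ((hder.log hu0.ne').const_mul (c / κ))).congr_deriv ?_
    field_simp
    ring
  · have h1 : |c * (X * (1 - κ * (s * X))⁻¹)| ≤ |c| * (X * 2) := by
      rw [abs_mul, abs_mul, abs_of_pos hX, abs_of_pos (inv_pos.2 hu0)]
      gcongr
    linarith [neg_abs_le (c * (X * (1 - κ * (s * X))⁻¹))]
  · rw [abs_mul, mul_comm, abs_of_pos (Real.rpow_pos_of_pos hu0 _)]
    refine mul_le_mul_of_nonneg_right ?_ (abs_nonneg t)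
    -- The `2 k`-th power of the factor is `(1 - κ s X)⁻¹ ≤ 2 ≤ 2 ^ (2 k)`, whence the constant `2`.
    refine (pow_le_pow_iff_left₀ (Real.rpow_pos_of_pos hu0 _).le two_pos.le
      (show 2 * k ≠ 0 by omega)).1 ?_
    have := mul_rpow_pow_two_mul hk 1 hu0
    rw [one_mul, one_pow, one_mul] at this
    rw [this]
    exact hinv.trans (le_self_pow₀ one_le_two (by omega))

end Spiral

/-! ### Realizing every formal class -/

/-- `M` is the half-turn germ of an analytic field `polarField A B`. -/
def IsHalfTurnGerm (M : ℝ → ℝ) : Prop :=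
  AnalyticAt ℝ M 0 ∧ M 0 = 0 ∧ deriv M 0 < 0 ∧
    ∃ (A B : ℝ × ℝ → ℝ) (C : ℝ), AnalyticOnNhd ℝ A univ ∧ AnalyticOnNhd ℝ B univ ∧ B 0 = 1 ∧
      ∀ᶠ t in 𝓝 0, t ≠ 0 → IsHalfTurn A B C t (M t)

theorem isHalfTurnGerm_linear {lam : ℝ} (hlam : 0 < lam) :
    IsHalfTurnGerm (fun t => -lam * t) := by
  refine ⟨by fun_prop, by simp, ?_, _, _, _, analyticOnNhd_const, analyticOnNhd_const, rfl,
    .of_forall fun t => isHalfTurn_linear hlam⟩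
  simpa using hlam

theorem IsHalfTurnTime.isHalfTurnGerm {k : ℕ} {κ ε c : ℝ} {w : ℝ → ℝ} (hw : IsHalfTurnTime κ c w)
    (hk : 1 ≤ k) (hε : ε ≠ 0) (hκ : κ = 2 * k * ε) : IsHalfTurnGerm (spiralGerm k κ w) := by
  have hρ : ∀ p : ℝ × ℝ, AnalyticAt ℝ (fun p : ℝ × ℝ => p.1 ^ 2 + p.2 ^ 2) p :=
    fun p => (analyticAt_fst.pow 2).add (analyticAt_snd.pow 2)
  refine ⟨hw.analyticAt_spiralGerm hk, spiralGerm_zero, ?_, _, _, _, ?_, ?_, ?_,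
    hw.isHalfTurn hk hε hκ⟩
  · rw [hw.deriv_spiralGerm hk]; norm_num
  · exact fun p _ => analyticAt_const.mul ((hρ p).pow k)
  · exact fun p _ => analyticAt_const.add (analyticAt_const.mul ((hρ p).pow k))
  · simp [show k ≠ 0 by omega]

theorem exists_isHalfTurnGerm_nearConj {h : ℝ → ℝ} {lam : ℝ} (hlam : 0 < lam)
    (ha : AnalyticAt ℝ h 0) (hh : (fun t => h t - (-lam * t)) =o[𝓝 0] (fun t => t)) :
    ∃ M, IsHalfTurnGerm M ∧ ∀ n, NearConj n h M := by
  rcases ne_or_eq lam 1 with h1 | rfl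
  · exact ⟨_, isHalfTurnGerm_linear hlam, nearConj_linear hlam h1 ha hh⟩
  rcases nearConj_neg_or_resonant ha hh with H | ⟨k, hk, a, ha0, φ, ψ, hc, hf⟩
  · exact ⟨_, isHalfTurnGerm_linear one_pos, H⟩
  have h0 := (isLittleO_sub_mul_id_iff.1 hh).1
  obtain ⟨ε, hε⟩ : ∃ ε : ℝ, -(ε * Real.pi) = a :=
    ⟨-a / Real.pi, by rw [div_mul_cancel₀ _ Real.pi_ne_zero, neg_neg]⟩
  have hε0 : ε ≠ 0 := by rintro rfl; simp at hε; exact ha0 hε.symm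
  obtain ⟨M, hM, hMn⟩ := exists_nearConj_of_family (G := {M | IsHalfTurnGerm M})
    (hc.analyticAt_conj ha h0) ha0 hk hf
    ((isHalfTurnTime_zero (2 * k * ε)).analyticAt_spiralGerm hk)
    (hε ▸ isLittleO_spiralGerm_leading hk rfl) (fun d => by
      -- This `c` makes the shift `ε c π` equal to `d`.
      obtain ⟨w, hw⟩ := exists_isHalfTurnTime (2 * k * ε) (d / (ε * Real.pi))
      refine ⟨_, hw.isHalfTurnGerm hk hε0 rfl, hw.analyticAt_spiralGerm hk,
        (hw.isLittleO_spiralGerm_sub hk hε0 rfl).congr_left fun t => ?_⟩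
      have := Real.pi_ne_zero
      field_simp)
  exact ⟨M, hM, fun n => (hMn n).comp_left hc⟩

theorem mainTheorem8 (h : ℝ → ℝ) (lam : ℝ) (hlam : 0 < lam)
    (h_analytic : AnalyticAt ℝ h 0)
    (h_expansion : (fun t => h t - (-lam * t)) =o[𝓝 0] (fun t => t)) (N : ℕ) :
    ∃ (U : Set (ℝ × ℝ)) (V : ℝ × ℝ → ℝ × ℝ) (m : ℝ → ℝ),
      IsOpen U ∧ (0 : ℝ × ℝ) ∈ U ∧ AnalyticOnNhd ℝ V U ∧
      IsNondegenerateMonodromic V ∧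
      (∀ δ : ℝ, 0 < δ → IsSemiMonodromy U V (fun t => (t, 0)) δ m) ∧
      FormallyEquivalent m h ∧
      (fun t => h t - m t) =o[𝓝 0] (fun t => t ^ N) := by
  obtain ⟨M, ⟨hM, hM0, hM1, A, B, C, hA, hB, hB0, hturn⟩, H⟩ :=
    exists_isHalfTurnGerm_nearConj hlam h_analytic h_expansion
  obtain ⟨h0, hd⟩ := isLittleO_sub_mul_id_iff.1 h_expansion
  have hh := tendsto_zero_of_hasDerivAt h0 hd
  have hMt := tendsto_zero_of_hasDerivAt hM0 hM.differentiableAt.hasDerivAt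
  obtain ⟨φ, ψ, hc, hN⟩ := H N
  obtain ⟨U, V, hU, h0U, hV, hmono, hsemi⟩ :=
    exists_field_of_isHalfTurn hA hB hB0 hM hM0 hM1 hturn hc
  exact ⟨U, V, fun t => ψ (M (φ t)), hU, h0U, hV, hmono, hsemi,
    formallyEquivalent_of_nearConj hc hh hMt H, NearConj.isLittleO_pullback hc hh hMt hN⟩
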